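/- There are absolute constants $C,c>0$ such that the following holds. Let $L,T\ge 1$ be integers, $\theta>0$ and $K>0$. For an integer $n\ge 1$ and a number of classes $n_L\ge 1$, let $n_0=n_1=\dots=n_{L-1}=n$, and consider the $L$-layer sign (leak-free, $\beta=1$) integrate-and-fire network with weight matrices $W^{(l)}\in\mathbb{R}^{n_l\times n_{l-1}}$ ($1\le l\le L$): for an input sequence $(x_t)_{t=1}^T\in(\{-1,1\}^n)^T$ put $s^{(0)}_t=x_t$, $u^{(l)}_0=0$, $s^{(l)}_0=-(1,\dots,1)$ for $l\ge 1$, and $$u^{(l)}_t=u^{(l)}_{t-1}+W^{(l)}s^{(l-1)}_t-\tfrac{\theta}{2}\big(s^{(l)}_{t-1}+1\big),\qquad s^{(l)}_t=\operatorname{sign}\big(u^{(l)}_t-\theta\big),\qquad 1\le t\le T,$$ where $\operatorname{sign}(z)=1$ for $z\ge 0$ and $-1$ otherwise, coordinatewise. The classifier is $f^{L,T}((x_t)_{t\in[T]},W)=\arg\max_{i\in[n_L]}\sum_{t=1}^T s^{(L)}_{t,i}$, with any fixed rule, depending only on the spike counts, for breaking ties. Let all entries of the matrices $W^{(l)}$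 be independent with law $\mathcal{N}(0,1/n)$. Then there is $n_0^*=n_0^*(L,T,\theta,K)$ such that for all $n\ge n_0^*$, all $n_L\ge 1$, and all $x_1,\dots,x_T,y_1,\dots,y_T\in\{-1,1\}^n$ whose Hamming distances are $d_H(x_t,y_t)=\lfloor\nu_t n\rfloor$ with $\nu_t\in[0,1]$ and $\nu:=\max_{t\in[T]}\nu_t\le K/\sqrt n$, $$\mathbb{P}_W\Big(f^{L,T}((x_t)_{t\in[T]},W)\ne f^{L,T}((y_t)_{t\in[T]},W)\Big)\le n_L T^4 C(1+\theta)\,\nu^{\frac{1}{2^{2L+1}}}\log^{3/2}n+(L-1)\,e^{-c\,\nu^{\frac{1}{2^{2L-1}}}n}.$$ -/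

import Mathlib

open MeasureTheory ProbabilityTheory

noncomputable section

/-- The sign function with values in `{-1, 1}` and `sign 0 = 1`. -/
def pmSign (z : ℝ) : ℝ := if 0 ≤ z then 1 else -1

/-- State `(u_t, s_t)` (membrane potential, spike) at time `t` of a sign leaky integrate-and-fire
neuron with leak `β`, threshold `θ`, weights `w` and input sequence `x_1, x_2, …`:
`u_0 = 0`, no spike at time `0` (`s_0 = -1`),
`u_t = β u_{t-1} + ⟨w, x_t⟩ - (θ / 2) (s_{t-1} + 1)`, `s_t = sign (u_t - θ)`.
The state at time `t` depends on `x_1, …, x_t` only. -/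
def slifState (β θ : ℝ) {m : ℕ} (w : Fin m → ℝ) (x : ℕ → Fin m → ℝ) : ℕ → ℝ × ℝ
  | 0 => (0, -1)
  | t + 1 =>
    let p := slifState β θ w x t
    let u := β * p.1 + ∑ j, w j * x (t + 1) j - θ / 2 * (p.2 + 1)
    (u, pmSign (u - θ))

/-- The spike `s_t` of a single sLIF neuron. -/
def slifSpike (β θ : ℝ) {m : ℕ} (w : Fin m → ℝ) (x : ℕ → Fin m → ℝ) (t : ℕ) : ℝ :=
  (slifState β θ w x t).2

/-- Weights of an `L`-layer network with widths `N 0, …, N L`: the matrix between the layers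
`l` and `l + 1` has size `N (l + 1) × N l`. -/
abbrev SNNWeights {L : ℕ} (N : Fin (L + 1) → ℕ) : Type :=
  (l : Fin L) → Fin (N l.succ) → Fin (N l.castSucc) → ℝ

/-- Spike sequences of all layers of the sLIF network: `s^{(0)} = x`, and neuron `i` of layer
`l + 1` is an sLIF neuron whose weights are row `i` of the matrix `W l` and whose input sequence
is the spike sequence of layer `l`. -/
def snnSpikes (β θ : ℝ) {L : ℕ} (N : Fin (L + 1) → ℕ) (W : SNNWeights N)
    (x : ℕ → Fin (N 0) → ℝ) (l : Fin (L + 1)) : ℕ → Fin (N l) → ℝ :=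
  Fin.induction (motive := fun l => ℕ → Fin (N l) → ℝ) x
    (fun l s t i => slifSpike β θ (W l i) s t) l

/-- `sel` is a version of `arg max` (a maximizer, with an arbitrary rule for breaking ties). -/
def IsArgmax {k : ℕ} (sel : (Fin k → ℝ) → Fin k) : Prop :=
  ∀ (v : Fin k → ℝ) (i : Fin k), v i ≤ v (sel v)

/-- The classifier: arg max over output neurons `i` of `∑_{t=1}^T s^{(L)}_{t,i}`. -/
def snnClassifier (β θ : ℝ) {L : ℕ} (N : Fin (L + 1) → ℕ) (T : ℕ)
    (sel : (Fin (N (Fin.last L)) → ℝ) → Fin (N (Fin.last L)))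
    (x : ℕ → Fin (N 0) → ℝ) (W : SNNWeights N) : Fin (N (Fin.last L)) :=
  sel fun i => ∑ t ∈ Finset.Icc 1 T, snnSpikes β θ N W x (Fin.last L) t i

/-- The law of the weights: all entries independent, centered Gaussian of variance `1 / n`. -/
def snnGaussian {L : ℕ} (N : Fin (L + 1) → ℕ) (n : ℕ) : Measure (SNNWeights N) :=
  Measure.pi fun _ => Measure.pi fun _ => Measure.pi fun _ => gaussianReal 0 ((n : NNReal)⁻¹)

end

/-! Without leak, the potential is the accumulated input minus `θ` times the spike count. When two
runs of one neuron first disagree, their spike counts still agree, so the two accumulated inputs lie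
on different sides of some `k * θ` with `1 ≤ k ≤ T` (`exists_separated_of_slifSpike_ne`). Both are
centered Gaussian linear forms in the weights. As `k * θ` is away from the mean, one form lies
within `δ` of it with probability `O(δ / θ)`, whatever its variance; by Chebyshev the forms differ
by `δ` with probability at most `O(T ^ 2 q / (n δ ^ 2))`, where `q` counts the input coordinates
that ever differ.

This bound is linear in `q`, so averaging over the earlier layers replaces `q / n` by the mean flip
probability `p` of the previous layer; no concentration of `q` is needed. Taking `δ` of order `p ^
(1 / 4)` turns `p` into `O(p ^ (1 / 4))`, hence `O(ν ^ (1 / 4 ^ L))` after `L` layers. This power of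
`ν` is the square of the one claimed: since `ν ≤ K / √n`, one factor absorbs all constants depending
on `L, T, θ` for large `n`, and the other is the bound. -/

/-! ### Gaussian linear forms: anti-concentration and Chebyshev -/

/-- A centered Gaussian has density at most `1 / x` at `x > 0`, whatever its variance. -/
lemma gaussianPDFReal_zero_le_inv (v : NNReal) {x : ℝ} (hx : 0 < x) :
    gaussianPDFReal 0 v x ≤ x⁻¹ := by
  rcases eq_or_ne v 0 with rfl | hv
  · simpa using hx.le
  have hv' : (0 : ℝ) < v := by positivity
  set s : ℝ := √(2 * Real.pi * v) with hs
  have hs0 : 0 < s := by positivity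
  have hs2 : s ^ 2 = 2 * Real.pi * v := Real.sq_sqrt (by positivity)
  have hexp : Real.exp (-(x - 0) ^ 2 / (2 * v)) ≤ s / x := by
    have hr : x ^ 2 / (2 * v) * 2 + 1 ≤ Real.exp (x ^ 2 / (2 * v) * 2) := Real.add_one_le_exp _
    have hpi := Real.pi_gt_three
    -- With `r = x ^ 2 / v` the squared claim reads `v * r ≤ 2 * π * v * exp r`, a consequence of `r
    -- + 1 ≤ exp r`.
    have h1 : x ^ 2 ≤ (s * Real.exp (x ^ 2 / (2 * v))) ^ 2 := by
      rw [mul_pow, hs2, ← Real.exp_nat_mul]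
      push_cast
      rw [mul_comm (2 : ℝ) (x ^ 2 / (2 * v))]
      have : x ^ 2 = v * (x ^ 2 / (2 * v) * 2) := by field_simp
      nlinarith [Real.exp_pos (x ^ 2 / (2 * v) * 2)]
    have h2 : x ≤ s * Real.exp (x ^ 2 / (2 * v)) :=
      (pow_le_pow_iff_left₀ hx.le (by positivity) two_ne_zero).1 h1
    rw [sub_zero, neg_div, Real.exp_neg, le_div_iff₀ hx, inv_mul_le_iff₀ (Real.exp_pos _)]
    linarith
  rw [gaussianPDFReal_def]
  calc s⁻¹ * Real.exp (-(x - 0) ^ 2 / (2 * v)) ≤ s⁻¹ * (s / x) := by gcongr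
    _ = x⁻¹ := by field_simp

/-- Anti-concentration of a centered Gaussian away from its mean, uniform in the variance. -/
lemma gaussianReal_zero_abs_sub_le (v : NNReal) {a δ : ℝ} (ha : 0 < a) (hδ : 0 < δ) :
    gaussianReal 0 v {z | |z - a| ≤ δ} ≤ ENNReal.ofReal (4 * δ / a) := by
  -- For `δ ≥ a / 2` the bound exceeds `1`; otherwise the interval lies to the right of `a / 2`,
  -- where the density is at most `2 / a`.
  rcases le_or_gt (a / 2) δ with h | h
  · refine prob_le_one.trans ?_
    rw [ENNReal.one_le_ofReal, le_div_iff₀ ha]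
    linarith
  have hset : {z : ℝ | |z - a| ≤ δ} = Set.Icc (a - δ) (a + δ) := by
    ext z
    simp only [Set.mem_ofPred_eq, abs_le, Set.mem_Icc]
    constructor <;> rintro ⟨h1, h2⟩ <;> constructor <;> linarith
  rw [hset]
  rcases eq_or_ne v 0 with rfl | hv
  · rw [gaussianReal_zero_var, Measure.dirac_apply' _ measurableSet_Icc, Set.indicator_of_notMem]
    · simp
    · simp only [Set.mem_Icc, not_and_or, not_le]
      left
      linarith
  rw [gaussianReal_apply _ hv]
  calc ∫⁻ z in Set.Icc (a - δ) (a + δ), gaussianPDF 0 v z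
      ≤ ∫⁻ _ in Set.Icc (a - δ) (a + δ), ENNReal.ofReal (2 / a) := by
        refine setLIntegral_mono measurable_const fun z hz => ?_
        refine ENNReal.ofReal_le_ofReal ?_
        have hz0 : a / 2 < z := by linarith [hz.1]
        refine (gaussianPDFReal_zero_le_inv v (by linarith)).trans ?_
        rw [← inv_div]
        exact inv_anti₀ (by positivity) hz0.le
    _ = ENNReal.ofReal (4 * δ / a) := by
        rw [setLIntegral_const, Real.volume_Icc, ← ENNReal.ofReal_mul (by positivity)]
        congr 1
        ring

section LinearForm

variable {m : ℕ} (v : NNReal) (a : Fin m → ℝ)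

/-- The variance stays unevaluated because anti-concentration is uniform in it, degenerate forms
included; only Chebyshev needs its value. -/
lemma map_linearForm_pi_gaussianReal :
    (Measure.pi fun _ : Fin m => gaussianReal 0 v).map (fun w => ∑ j, w j * a j) =
      gaussianReal 0 (Var[fun w => ∑ j, w j * a j;
        Measure.pi fun _ : Fin m => gaussianReal 0 v]).toNNReal := by
  have hlaw (j : Fin m) : HasGaussianLaw (fun w : Fin m → ℝ => w j * a j)
      (Measure.pi fun _ : Fin m => gaussianReal 0 v) := by
    refine ⟨?_⟩
    have : (fun w : Fin m → ℝ => w j * a j) = (fun z => z * a j) ∘ Function.eval j := rfl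
    rw [this, ← Measure.map_map (by fun_prop) (by fun_prop),
      (measurePreserving_eval (fun _ : Fin m => gaussianReal 0 v) j).map_eq,
      gaussianReal_map_mul_const]
    infer_instance
  have hind : iIndepFun (fun (j : Fin m) (w : Fin m → ℝ) => w j * a j)
      (Measure.pi fun _ : Fin m => gaussianReal 0 v) :=
    iIndepFun_pi (X := fun j z => z * a j) fun j => by fun_prop
  have hsum := iIndepFun.hasGaussianLaw_fun_sum hlaw hind
  rw [hsum.map_eq_gaussianReal]
  congr 1
  rw [integral_finsetSum _ fun j _ => (hlaw j).integrable]
  refine Finset.sum_eq_zero fun j _ => ?_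
  rw [integral_comp_eval (μ := fun _ : Fin m => gaussianReal 0 v) (i := j)
    (f := fun z => z * a j) (by fun_prop), integral_mul_const, integral_id_gaussianReal, zero_mul]

lemma variance_linearForm_pi_gaussianReal :
    Var[fun w => ∑ j, w j * a j; Measure.pi fun _ : Fin m => gaussianReal 0 v] =
      v * ∑ j, a j ^ 2 := by
  have h := variance_sum_pi (μ := fun _ : Fin m => gaussianReal 0 v)
    (X := fun j z => z * a j) fun j => (memLp_id_gaussianReal 2).mul_const (a j)
  have h2 : (fun w : Fin m → ℝ => ∑ j, w j * a j) = ∑ j, fun w => w j * a j := by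
    ext w; simp
  rw [h2, h, Finset.mul_sum]
  refine Finset.sum_congr rfl fun j _ => ?_
  rw [variance_mul_const, variance_fun_id_gaussianReal]

lemma pi_gaussianReal_abs_linearForm_sub_le {b δ : ℝ} (hb : 0 < b) (hδ : 0 < δ) :
    (Measure.pi fun _ : Fin m => gaussianReal 0 v) {w | |∑ j, w j * a j - b| ≤ δ} ≤
      ENNReal.ofReal (4 * δ / b) := by
  have h := gaussianReal_zero_abs_sub_le (Var[fun w => ∑ j, w j * a j;
    Measure.pi fun _ : Fin m => gaussianReal 0 v]).toNNReal hb hδ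
  rwa [← map_linearForm_pi_gaussianReal v a, Measure.map_apply (by fun_prop)
    (measurableSet_le (by fun_prop) measurable_const)] at h

lemma pi_gaussianReal_le_abs_linearForm {δ : ℝ} (hδ : 0 < δ) :
    (Measure.pi fun _ : Fin m => gaussianReal 0 v) {w | δ ≤ |∑ j, w j * a j|} ≤
      ENNReal.ofReal (v * (∑ j, a j ^ 2) / δ ^ 2) := by
  have h1 := meas_ge_le_variance_div_sq (memLp_id_gaussianReal (μ := 0)
    (v := (Var[fun w => ∑ j, w j * a j;
        Measure.pi fun _ : Fin m => gaussianReal 0 v]).toNNReal) 2) hδ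
  rw [variance_id_gaussianReal, Real.coe_toNNReal _ (variance_nonneg _ _),
    ← map_linearForm_pi_gaussianReal v a, Measure.map_apply (by fun_prop)
      (measurableSet_le measurable_const (by fun_prop)), variance_linearForm_pi_gaussianReal] at h1
  rw [map_linearForm_pi_gaussianReal v a] at h1
  simpa [integral_id_gaussianReal] using h1

end LinearForm

/-- Two correlated Gaussian linear forms are rarely separated by a positive threshold `b`. -/
lemma pi_gaussianReal_abs_linearForm_sub_le_abs_sub {m : ℕ} (v : NNReal) (a a' : Fin m → ℝ)
    {b δ : ℝ} (hb : 0 < b) (hδ : 0 < δ) :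
    (Measure.pi fun _ : Fin m => gaussianReal 0 v)
        {w | |∑ j, w j * a j - b| ≤ |∑ j, w j * a j - ∑ j, w j * a' j|} ≤
      ENNReal.ofReal (4 * δ / b) + ENNReal.ofReal (v * (∑ j, (a j - a' j) ^ 2) / δ ^ 2) := by
  refine le_trans ?_ (add_le_add (pi_gaussianReal_abs_linearForm_sub_le v a hb hδ)
    (pi_gaussianReal_le_abs_linearForm v (fun j => a j - a' j) hδ))
  refine le_trans (measure_mono fun w hw => ?_) (measure_union_le _ _)
  simp only [Set.mem_ofPred_eq, Set.mem_union, mul_sub, Finset.sum_sub_distrib] at hw ⊢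
  rcases le_total (|∑ j, w j * a j - b|) δ with h | h
  · exact Or.inl h
  · exact Or.inr (h.trans hw)

/-! ### Stability of a single neuron -/

section Neuron

variable {m : ℕ} (θ : ℝ) (w : Fin m → ℝ) (x y : ℕ → Fin m → ℝ)

lemma pmSign_eq (z : ℝ) : pmSign z = 1 ∨ pmSign z = -1 := by
  unfold pmSign
  split_ifs <;> simp

lemma abs_le_abs_sub_of_pmSign_ne {z z' : ℝ} (h : pmSign z ≠ pmSign z') : |z| ≤ |z - z'| := by
  unfold pmSign at h
  split_ifs at h with h1 h2 h2
  · simp at h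
  · rw [abs_of_nonneg h1]
    exact le_trans (by linarith) (le_abs_self _)
  · rw [abs_of_neg (by linarith), abs_sub_comm]
    exact le_trans (by linarith) (le_abs_self _)
  · simp at h

lemma slifSpike_eq (β : ℝ) (t : ℕ) : slifSpike β θ w x t = 1 ∨ slifSpike β θ w x t = -1 := by
  cases t with
  | zero => exact Or.inr rfl
  | succ t => exact pmSign_eq _

/-- Without leak, the potential is the accumulated input minus `θ` times the number of earlier
spikes. -/
lemma slifState_one_succ_fst (t : ℕ) :
    (slifState 1 θ w x (t + 1)).1 = ∑ j, w j * ∑ r ∈ Finset.Icc 1 (t + 1), x r j -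
      ((Finset.Icc 1 t).filter fun r => slifSpike 1 θ w x r = 1).card * θ := by
  induction t with
  | zero => simp [slifState]
  | succ t ih =>
    have hu : (slifState 1 θ w x (t + 1 + 1)).1 = 1 * (slifState 1 θ w x (t + 1)).1 +
        ∑ j, w j * x (t + 1 + 1) j - θ / 2 * (slifSpike 1 θ w x (t + 1) + 1) := rfl
    have hx : ∑ j, w j * ∑ r ∈ Finset.Icc 1 (t + 1 + 1), x r j =
        ∑ j, w j * ∑ r ∈ Finset.Icc 1 (t + 1), x r j + ∑ j, w j * x (t + 1 + 1) j := by
      rw [← Finset.sum_add_distrib]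
      refine Finset.sum_congr rfl fun j _ => ?_
      rw [Finset.sum_Icc_succ_top (by lia), mul_add]
    rw [hu, ih, hx, ← Finset.insert_Icc_right_eq_Icc_add_one (a := 1) (b := t) (by lia),
      Finset.filter_insert]
    rcases slifSpike_eq θ w x 1 (t + 1) with h | h
    · rw [if_pos h, Finset.card_insert_of_notMem (by simp), h]
      push_cast
      ring
    · rw [if_neg (by rw [h]; norm_num), h]
      ring

/-- If the spikes of a neuron on two inputs differ, then at some time the two accumulated inputs
are separated by a multiple of `θ`. -/
lemma exists_separated_of_slifSpike_ne {T : ℕ}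
    (h : ∃ t ∈ Finset.Icc 1 T, slifSpike 1 θ w x t ≠ slifSpike 1 θ w y t) :
    ∃ t ∈ Finset.Icc 1 T, ∃ k ∈ Finset.Icc 1 T,
      |∑ j, w j * ∑ r ∈ Finset.Icc 1 t, x r j - k * θ| ≤
        |∑ j, w j * ∑ r ∈ Finset.Icc 1 t, x r j - ∑ j, w j * ∑ r ∈ Finset.Icc 1 t, y r j| := by
  classical
  have hmin {r : ℕ} := Nat.find_min h (m := r)
  obtain ⟨hmem, hne⟩ := Nat.find_spec h
  set t := Nat.find h
  obtain ⟨s, hs⟩ : ∃ s, t = s + 1 := ⟨t - 1, by have := (Finset.mem_Icc.1 hmem).1; lia⟩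
  rw [hs] at hmem hne hmin
  -- `s + 1` is the first disagreement, so up to time `s` both runs have lost the same multiple of
  -- `θ`.
  have hagree (r : ℕ) (hr : r ∈ Finset.Icc 1 s) : slifSpike 1 θ w x r = slifSpike 1 θ w y r := by
    by_contra hc
    rw [Finset.mem_Icc] at hr hmem
    exact hmin (by lia : r < s + 1) ⟨Finset.mem_Icc.2 ⟨hr.1, by lia⟩, hc⟩
  have hcard : (Finset.Icc 1 s).filter (fun r => slifSpike 1 θ w y r = 1) =
      (Finset.Icc 1 s).filter fun r => slifSpike 1 θ w x r = 1 :=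
    Finset.filter_congr fun r hr => by rw [hagree r hr]
  have hx := slifState_one_succ_fst θ w x s
  have hy := slifState_one_succ_fst θ w y s
  rw [hcard] at hy
  set k := ((Finset.Icc 1 s).filter fun r => slifSpike 1 θ w x r = 1).card
  have hk : k ≤ s := (Finset.card_filter_le _ _).trans (by simp)
  -- Comparing the potential with `θ` after `k` resets compares the accumulated input with `(k + 1)
  -- * θ`, which is never the mean `0`.
  refine ⟨s + 1, hmem, k + 1, ?_, ?_⟩
  · rw [Finset.mem_Icc] at hmem ⊢
    lia
  · have hx' : slifSpike 1 θ w x (s + 1) = pmSign ((slifState 1 θ w x (s + 1)).1 - θ) := rfl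
    have hy' : slifSpike 1 θ w y (s + 1) = pmSign ((slifState 1 θ w y (s + 1)).1 - θ) := rfl
    rw [hx', hy', hx, hy] at hne
    have := abs_le_abs_sub_of_pmSign_ne hne
    push_cast
    convert this using 2 <;> ring

end Neuron

/-- A Gaussian neuron is stable: the probability that its spikes on two inputs with values in
`[-1, 1]` differ before time `T` is controlled by the number of differing coordinates. -/
lemma pi_gaussianReal_slifSpike_ne_le {m : ℕ} (v : NNReal) {T : ℕ} {θ δ : ℝ} (hθ : 0 < θ)
    (hδ : 0 < δ) {x y : ℕ → Fin m → ℝ} (hx : ∀ t ∈ Finset.Icc 1 T, ∀ j, |x t j| ≤ 1)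
    (hy : ∀ t ∈ Finset.Icc 1 T, ∀ j, |y t j| ≤ 1) :
    (Measure.pi fun _ : Fin m => gaussianReal 0 v)
        {w | ∃ t ∈ Finset.Icc 1 T, slifSpike 1 θ w x t ≠ slifSpike 1 θ w y t} ≤
      ENNReal.ofReal (T ^ 2 * (4 * δ / θ)) + ENNReal.ofReal (T ^ 2 * (v * (2 * T) ^ 2 / δ ^ 2)) *
        ∑ j, {j | ∃ t ∈ Finset.Icc 1 T, x t j ≠ y t j}.indicator 1 j := by
  classical
  set q : ℝ := ∑ j, {j | ∃ t ∈ Finset.Icc 1 T, x t j ≠ y t j}.indicator (1 : Fin m → ℝ) j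
    with hq
  have hq0 : 0 ≤ q := Finset.sum_nonneg fun j _ => Set.indicator_nonneg (by simp) _
  have hqe : ∑ j, {j | ∃ t ∈ Finset.Icc 1 T, x t j ≠ y t j}.indicator
      (1 : Fin m → ENNReal) j = ENNReal.ofReal q := by
    rw [hq, ENNReal.ofReal_sum_of_nonneg fun j _ => Set.indicator_nonneg (by simp) _]
    refine Finset.sum_congr rfl fun j _ => ?_
    simp only [Set.indicator_apply]
    split_ifs <;> simp
  have hD (t : ℕ) (ht : t ∈ Finset.Icc 1 T) :
      ∑ j, (∑ r ∈ Finset.Icc 1 t, x r j - ∑ r ∈ Finset.Icc 1 t, y r j) ^ 2 ≤ (2 * T) ^ 2 * q := by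
    rw [hq, Finset.mul_sum]
    refine Finset.sum_le_sum fun j _ => ?_
    rw [← Finset.sum_sub_distrib]
    have hsub {r : ℕ} (hr : r ∈ Finset.Icc 1 t) : r ∈ Finset.Icc 1 T := by
      rw [Finset.mem_Icc] at *
      lia
    by_cases hj : ∃ t ∈ Finset.Icc 1 T, x t j ≠ y t j
    · rw [Set.indicator_of_mem (by exact hj), Pi.one_apply, mul_one, sq_le_sq]
      calc |∑ r ∈ Finset.Icc 1 t, (x r j - y r j)|
          ≤ ∑ r ∈ Finset.Icc 1 t, |x r j - y r j| := Finset.abs_sum_le_sum_abs _ _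
        _ ≤ ∑ r ∈ Finset.Icc 1 t, (2 : ℝ) := Finset.sum_le_sum fun r hr => by
            have h1 := abs_sub (x r j) (y r j)
            have h2 := hx r (hsub hr) j
            have h3 := hy r (hsub hr) j
            linarith
        _ = 2 * t := by simp [mul_comm]
        _ ≤ 2 * T := by
            have : (t : ℝ) ≤ T := by exact_mod_cast (Finset.mem_Icc.1 ht).2
            linarith
        _ ≤ |2 * (T : ℝ)| := le_abs_self _
    · push Not at hj
      rw [Finset.sum_eq_zero fun r hr => sub_eq_zero.2 (hj r (hsub hr))]
      simpa using mul_nonneg (by positivity) (Set.indicator_nonneg (by simp) _)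
  rw [hqe]
  calc (Measure.pi fun _ : Fin m => gaussianReal 0 v)
        {w | ∃ t ∈ Finset.Icc 1 T, slifSpike 1 θ w x t ≠ slifSpike 1 θ w y t}
      ≤ (Measure.pi fun _ : Fin m => gaussianReal 0 v)
        (⋃ t ∈ Finset.Icc 1 T, ⋃ k ∈ Finset.Icc 1 T,
          {w | |∑ j, w j * ∑ r ∈ Finset.Icc 1 t, x r j - k * θ| ≤
            |∑ j, w j * ∑ r ∈ Finset.Icc 1 t, x r j -
              ∑ j, w j * ∑ r ∈ Finset.Icc 1 t, y r j|}) := by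
        refine measure_mono fun w hw => ?_
        simp only [Set.mem_iUnion]
        obtain ⟨t, ht, k, hk, h⟩ := exists_separated_of_slifSpike_ne θ w x y hw
        exact ⟨t, ht, k, hk, h⟩
    _ ≤ ∑ t ∈ Finset.Icc 1 T, ∑ k ∈ Finset.Icc 1 T, (ENNReal.ofReal (4 * δ / θ) +
          ENNReal.ofReal (v * (2 * T) ^ 2 / δ ^ 2 * q)) := by
        refine (measure_biUnion_finset_le _ _).trans (Finset.sum_le_sum fun t ht => ?_)
        refine (measure_biUnion_finset_le _ _).trans (Finset.sum_le_sum fun k hk => ?_)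
        -- The threshold `k * θ` is at least `θ`, which makes the bound uniform in `k`.
        have hk1 : (1 : ℝ) ≤ k := by exact_mod_cast (Finset.mem_Icc.1 hk).1
        refine (pi_gaussianReal_abs_linearForm_sub_le_abs_sub v _ _
          (by positivity : 0 < k * θ) hδ).trans ?_
        gcongr ENNReal.ofReal ?_ + ENNReal.ofReal ?_
        · gcongr
          nlinarith
        · calc v * (∑ j, (∑ r ∈ Finset.Icc 1 t, x r j - ∑ r ∈ Finset.Icc 1 t, y r j) ^ 2) / δ ^ 2
              ≤ v * ((2 * T) ^ 2 * q) / δ ^ 2 := by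
                gcongr
                exact hD t ht
            _ = v * (2 * T) ^ 2 / δ ^ 2 * q := by ring
    _ = _ := by
        rw [← ENNReal.ofReal_add (by positivity) (by positivity),
          ← ENNReal.ofReal_mul (by positivity),
          ← ENNReal.ofReal_add (by positivity) (by positivity)]
        simp only [Finset.sum_const, Nat.card_Icc, Nat.add_sub_cancel, nsmul_eq_mul]
        rw [← ENNReal.ofReal_natCast, ← ENNReal.ofReal_mul (by positivity),
          ← ENNReal.ofReal_mul (by positivity)]
        congr 1
        ring

/-! ### One layer, averaged over the previous ones -/

section Network

variable {L : ℕ} {N : Fin (L + 1) → ℕ} (β θ : ℝ)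

lemma snnSpikes_succ (W : SNNWeights N) (x : ℕ → Fin (N 0) → ℝ) (l : Fin L) (t : ℕ)
    (i : Fin (N l.succ)) :
    snnSpikes β θ N W x l.succ t i =
      slifSpike β θ (W l i) (snnSpikes β θ N W x l.castSucc) t := by
  simp [snnSpikes]

lemma snnSpikes_congr {W W' : SNNWeights N} (x : ℕ → Fin (N 0) → ℝ) (l : Fin (L + 1))
    (h : ∀ k : Fin L, (k : ℕ) < l → W k = W' k) :
    snnSpikes β θ N W x l = snnSpikes β θ N W' x l := by
  induction l using Fin.induction with
  | zero => rfl
  | succ l ih =>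
    ext t i
    rw [snnSpikes_succ, snnSpikes_succ, h l (by simp),
      ih fun k hk => h k (by simp only [Fin.val_castSucc, Fin.val_succ] at *; lia)]

lemma abs_snnSpikes_le_one (W : SNNWeights N) {x : ℕ → Fin (N 0) → ℝ} {T : ℕ}
    (hx : ∀ t ∈ Finset.Icc 1 T, ∀ i, |x t i| ≤ 1) (l : Fin (L + 1)) :
    ∀ t ∈ Finset.Icc 1 T, ∀ i, |snnSpikes β θ N W x l t i| ≤ 1 := by
  cases l using Fin.cases with
  | zero => exact hx
  | succ l =>
    intro t _ i
    rw [snnSpikes_succ]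
    rcases slifSpike_eq θ (W l i) (snnSpikes β θ N W x l.castSucc) β t with h | h <;> simp [h]

lemma measurable_pmSign : Measurable pmSign :=
  Measurable.ite (measurableSet_le measurable_const measurable_id) measurable_const
    measurable_const

lemma measurable_slifState {Ω : Type*} [MeasurableSpace Ω] {m : ℕ} {w : Ω → Fin m → ℝ}
    {x : Ω → ℕ → Fin m → ℝ} (hw : ∀ j, Measurable fun ω => w ω j)
    (hx : ∀ t j, Measurable fun ω => x ω t j) (t : ℕ) :
    Measurable fun ω => slifState β θ (w ω) (x ω) t := by
  induction t with
  | zero => exact measurable_const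
  | succ t ih =>
    have hu : Measurable fun ω => β * (slifState β θ (w ω) (x ω) t).1 +
        ∑ j, w ω j * x ω (t + 1) j - θ / 2 * ((slifState β θ (w ω) (x ω) t).2 + 1) :=
      ((ih.fst.const_mul β).add
        (Finset.measurable_fun_sum _ fun j _ => (hw j).mul (hx (t + 1) j))).sub
        ((ih.snd.add_const 1).const_mul _)
    exact hu.prodMk (measurable_pmSign.comp (hu.sub_const θ))

lemma measurable_slifSpike {Ω : Type*} [MeasurableSpace Ω] {m : ℕ} {w : Ω → Fin m → ℝ}
    {x : Ω → ℕ → Fin m → ℝ} (hw : ∀ j, Measurable fun ω => w ω j)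
    (hx : ∀ t j, Measurable fun ω => x ω t j) (t : ℕ) :
    Measurable fun ω => slifSpike β θ (w ω) (x ω) t :=
  (measurable_slifState β θ hw hx t).snd

lemma measurable_snnSpikes (x : ℕ → Fin (N 0) → ℝ) (l : Fin (L + 1)) (t : ℕ) (i : Fin (N l)) :
    Measurable fun W : SNNWeights N => snnSpikes β θ N W x l t i := by
  induction l using Fin.induction generalizing t with
  | zero => exact measurable_const
  | succ l ih =>
    simp only [snnSpikes_succ]
    exact measurable_slifSpike β θ (fun j => by fun_prop) (fun t j => ih t j) t

/-- The event that neuron `i` of layer `l` spikes differently on the inputs `x` and `y` at some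
time `1 ≤ t ≤ T`. -/
def spikesDiffer (β θ : ℝ) (N : Fin (L + 1) → ℕ) (T : ℕ) (x y : ℕ → Fin (N 0) → ℝ)
    (l : Fin (L + 1)) (i : Fin (N l)) : Set (SNNWeights N) :=
  {W | ∃ t ∈ Finset.Icc 1 T, snnSpikes β θ N W x l t i ≠ snnSpikes β θ N W y l t i}

lemma measurableSet_exists_mem_Icc_ne {Ω : Type*} [MeasurableSpace Ω] {f g : ℕ → Ω → ℝ} (T : ℕ)
    (hf : ∀ t, Measurable (f t)) (hg : ∀ t, Measurable (g t)) :
    MeasurableSet {ω | ∃ t ∈ Finset.Icc 1 T, f t ω ≠ g t ω} := by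
  have : {ω | ∃ t ∈ Finset.Icc 1 T, f t ω ≠ g t ω} =
      ⋃ t ∈ Finset.Icc 1 T, {ω | f t ω = g t ω}ᶜ := by
    ext ω
    simp
  rw [this]
  exact Finset.measurableSet_biUnion _ fun t _ => (measurableSet_eq_fun (hf t) (hg t)).compl

lemma measurableSet_spikesDiffer (T : ℕ) (x y : ℕ → Fin (N 0) → ℝ) (l : Fin (L + 1))
    (i : Fin (N l)) : MeasurableSet (spikesDiffer β θ N T x y l i) :=
  measurableSet_exists_mem_Icc_ne T (fun t => measurable_snnSpikes β θ x l t i)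
    (fun t => measurable_snnSpikes β θ y l t i)

instance isProbabilityMeasure_snnGaussian (n : ℕ) : IsProbabilityMeasure (snnGaussian N n) := by
  unfold snnGaussian
  infer_instance

/-- One layer propagates the probability that a neuron spikes differently. -/
lemma snnGaussian_spikesDiffer_succ_le (n : ℕ) {T : ℕ} {θ δ : ℝ} (hθ : 0 < θ) (hδ : 0 < δ)
    {x y : ℕ → Fin (N 0) → ℝ} (hx : ∀ t ∈ Finset.Icc 1 T, ∀ j, |x t j| ≤ 1)
    (hy : ∀ t ∈ Finset.Icc 1 T, ∀ j, |y t j| ≤ 1) (l : Fin L) (i : Fin (N l.succ)) :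
    snnGaussian N n (spikesDiffer 1 θ N T x y l.succ i) ≤
      ENNReal.ofReal (T ^ 2 * (4 * δ / θ)) +
        ENNReal.ofReal (T ^ 2 * (((n : NNReal)⁻¹ : NNReal) * (2 * T) ^ 2 / δ ^ 2)) *
          ∑ j, snnGaussian N n (spikesDiffer 1 θ N T x y l.castSucc j) := by
  set a := ENNReal.ofReal (T ^ 2 * (4 * δ / θ))
  set b := ENNReal.ofReal (T ^ 2 * (((n : NNReal)⁻¹ : NNReal) * (2 * T) ^ 2 / δ ^ 2))
  have hS (k : Fin (L + 1)) (j : Fin (N k)) := measurableSet_spikesDiffer 1 θ T x y k j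
  have hind (k : Fin (L + 1)) (j : Fin (N k)) :
      Measurable ((spikesDiffer 1 θ N T x y k j).indicator (1 : SNNWeights N → ENNReal)) :=
    measurable_one.indicator (hS k j)
  have hsum : Measurable fun W : SNNWeights N =>
      ∑ j, (spikesDiffer 1 θ N T x y l.castSucc j).indicator (1 : SNNWeights N → ENNReal) W :=
    Finset.measurable_fun_sum _ fun j _ => hind _ j
  calc snnGaussian N n (spikesDiffer 1 θ N T x y l.succ i)
      = ∫⁻ W, (spikesDiffer 1 θ N T x y l.succ i).indicator 1 W ∂snnGaussian N n :=
        (lintegral_indicator_one (hS _ _)).symm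
    _ ≤ ∫⁻ W, (a + b * ∑ j, (spikesDiffer 1 θ N T x y l.castSucc j).indicator 1 W)
          ∂snnGaussian N n := by
        -- Only the matrix of layer `l` is integrated first: with the others frozen, the inputs of
        -- that layer are fixed sequences and the single-neuron bound applies.
        refine lintegral_le_of_lmarginal_le {l} (hind _ _) (by fun_prop) ?_
        rw [lmarginal_singleton, lmarginal_singleton]
        intro W
        have hupd (z : ℕ → Fin (N 0) → ℝ) (V : Fin (N l.succ) → Fin (N l.castSucc) → ℝ) :
            snnSpikes 1 θ N (Function.update W l V) z l.castSucc =
              snnSpikes 1 θ N W z l.castSucc :=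
          snnSpikes_congr 1 θ z _ fun k hk =>
            Function.update_of_ne (fun h => by simp [h] at hk) _ _
        have hleft (V : Fin (N l.succ) → Fin (N l.castSucc) → ℝ) :
            (spikesDiffer 1 θ N T x y l.succ i).indicator (1 : SNNWeights N → ENNReal)
                (Function.update W l V) =
              (Function.eval i ⁻¹' {w | ∃ t ∈ Finset.Icc 1 T,
                slifSpike 1 θ w (snnSpikes 1 θ N W x l.castSucc) t ≠
                  slifSpike 1 θ w (snnSpikes 1 θ N W y l.castSucc) t}).indicator 1 V := by
          have hiff : Function.update W l V ∈ spikesDiffer 1 θ N T x y l.succ i ↔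
              V ∈ Function.eval i ⁻¹' {w | ∃ t ∈ Finset.Icc 1 T,
                slifSpike 1 θ w (snnSpikes 1 θ N W x l.castSucc) t ≠
                  slifSpike 1 θ w (snnSpikes 1 θ N W y l.castSucc) t} := by
            simp only [spikesDiffer, snnSpikes_succ, hupd, Set.mem_ofPred_eq, Set.mem_preimage,
              Function.update_self, Function.eval]
          by_cases h : Function.update W l V ∈ spikesDiffer 1 θ N T x y l.succ i
          · rw [Set.indicator_of_mem h, Set.indicator_of_mem (hiff.1 h), Pi.one_apply,
              Pi.one_apply]
          · rw [Set.indicator_of_notMem h, Set.indicator_of_notMem fun h' => h (hiff.2 h')]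
        have hright (V : Fin (N l.succ) → Fin (N l.castSucc) → ℝ) (j : Fin (N l.castSucc)) :
            (spikesDiffer 1 θ N T x y l.castSucc j).indicator (1 : SNNWeights N → ENNReal)
                (Function.update W l V) =
              {j | ∃ t ∈ Finset.Icc 1 T, snnSpikes 1 θ N W x l.castSucc t j ≠
                snnSpikes 1 θ N W y l.castSucc t j}.indicator 1 j := by
          simp only [Set.indicator_apply, spikesDiffer, hupd, Set.mem_ofPred_eq, Pi.one_apply]
        have hE : MeasurableSet {w | ∃ t ∈ Finset.Icc 1 T,
            slifSpike 1 θ w (snnSpikes 1 θ N W x l.castSucc) t ≠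
              slifSpike 1 θ w (snnSpikes 1 θ N W y l.castSucc) t} :=
          measurableSet_exists_mem_Icc_ne T
            (fun t => measurable_slifSpike 1 θ
              (x := fun _ => snnSpikes 1 θ N W x l.castSucc)
              (fun j => measurable_pi_apply j) (fun _ _ => measurable_const) t)
            (fun t => measurable_slifSpike 1 θ
              (x := fun _ => snnSpikes 1 θ N W y l.castSucc)
              (fun j => measurable_pi_apply j) (fun _ _ => measurable_const) t)
        simp only [hleft, hright, lintegral_const, measure_univ, mul_one]
        rw [lintegral_indicator_one (measurable_pi_apply i hE),
          (measurePreserving_eval (fun _ : Fin (N l.succ) =>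
            Measure.pi fun _ : Fin (N l.castSucc) => gaussianReal 0 ((n : NNReal)⁻¹))
            i).measure_preimage hE.nullMeasurableSet]
        exact pi_gaussianReal_slifSpike_ne_le _ hθ hδ (abs_snnSpikes_le_one 1 θ W hx _)
          (abs_snnSpikes_le_one 1 θ W hy _)
    _ = a + b * ∑ j, snnGaussian N n (spikesDiffer 1 θ N T x y l.castSucc j) := by
        rw [lintegral_add_left measurable_const, lintegral_const, measure_univ, mul_one,
          lintegral_const_mul _ hsum, lintegral_finsetSum _ fun j _ => hind _ j]
        simp only [lintegral_indicator_one (hS _ _)]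

end Network

/-! ### Propagation through all layers -/

section Propagation

variable {L : ℕ} {N : Fin (L + 1) → ℕ}

/-- The factor lost in one layer when the flip probability `p` is replaced by `p ^ (1 / 4)`. -/
noncomputable def layerConst (T : ℕ) (θ : ℝ) : ℝ := T ^ 2 * (4 / θ + 4 * T ^ 2)

/-- The factor in the bound `C ν ^ (1 / 4 ^ l)` on the flip probability in layer `l`. -/
noncomputable def flipConst (T : ℕ) (θ : ℝ) : ℕ → ℝ
  | 0 => T
  | l + 1 => layerConst T θ * (1 + flipConst T θ l)

lemma layerConst_nonneg (T : ℕ) {θ : ℝ} (hθ : 0 < θ) : 0 ≤ layerConst T θ := by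
  unfold layerConst
  positivity

lemma flipConst_nonneg (T : ℕ) {θ : ℝ} (hθ : 0 < θ) (l : ℕ) : 0 ≤ flipConst T θ l := by
  induction l with
  | zero => exact Nat.cast_nonneg T
  | succ l ih => exact mul_nonneg (layerConst_nonneg T hθ) (by linarith)

/-- The variance `1 / n` cancels the factor `n`, leaving `δ + M * d ^ 4 / δ ^ 2` up to constants; `δ
= d` then suffices, as `d ^ 2 ≤ d`. -/
lemma snnGaussian_real_spikesDiffer_succ_le {n : ℕ} (hn : 0 < n) {T : ℕ} {θ : ℝ} (hθ : 0 < θ)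
    {x y : ℕ → Fin (N 0) → ℝ} (hx : ∀ t ∈ Finset.Icc 1 T, ∀ j, |x t j| ≤ 1)
    (hy : ∀ t ∈ Finset.Icc 1 T, ∀ j, |y t j| ≤ 1) (l : Fin L) {M d : ℝ} (hM : 0 ≤ M)
    (hd0 : 0 ≤ d) (hd1 : d ≤ 1)
    (hprev : ∑ j, (snnGaussian N n).real (spikesDiffer 1 θ N T x y l.castSucc j) ≤
      n * (M * d ^ 4)) (i : Fin (N l.succ)) :
    (snnGaussian N n).real (spikesDiffer 1 θ N T x y l.succ i) ≤
      layerConst T θ * (1 + M) * d := by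
  have hn' : (0 : ℝ) < n := by exact_mod_cast hn
  have key (δ : ℝ) (hδ : 0 < δ) :
      (snnGaussian N n).real (spikesDiffer 1 θ N T x y l.succ i) ≤
        layerConst T θ * (δ + M * (d ^ 4 / δ ^ 2)) := by
    have h := snnGaussian_spikesDiffer_succ_le n hθ hδ hx hy l i
    have hsum : ∑ j, snnGaussian N n (spikesDiffer 1 θ N T x y l.castSucc j) ≤
        ENNReal.ofReal (n * (M * d ^ 4)) := by
      refine le_trans (le_of_eq ?_) (ENNReal.ofReal_le_ofReal hprev)
      rw [ENNReal.ofReal_sum_of_nonneg fun _ _ => measureReal_nonneg]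
      exact Finset.sum_congr rfl fun j _ => (ofReal_measureReal (measure_ne_top _ _)).symm
    have h2 := h.trans (add_le_add_right (mul_le_mul_right hsum _) _)
    rw [← ENNReal.ofReal_mul (by positivity),
      ← ENNReal.ofReal_add (by positivity) (by positivity)] at h2
    refine (ENNReal.toReal_le_of_le_ofReal (by positivity) h2).trans ?_
    have hcancel : T ^ 2 * (((n : NNReal)⁻¹ : NNReal) * (2 * T) ^ 2 / δ ^ 2) *
        (n * (M * d ^ 4)) = T ^ 2 * (4 * T ^ 2) * (M * (d ^ 4 / δ ^ 2)) := by
      push_cast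
      field_simp
      ring
    rw [hcancel]
    -- `layerConst` puts the sum of both constants in front of both terms; the added cross terms are
    -- nonnegative.
    have hE : 0 ≤ M * (d ^ 4 / δ ^ 2) := by positivity
    have h3 : 0 ≤ (T : ℝ) ^ 2 * (4 * T ^ 2) * δ := by positivity
    have h4 : 0 ≤ (T : ℝ) ^ 2 * (4 / θ) * (M * (d ^ 4 / δ ^ 2)) := by positivity
    have h5 : (T : ℝ) ^ 2 * (4 * δ / θ) = T ^ 2 * (4 / θ) * δ := by ring
    rw [h5, layerConst]
    linarith
  have hA := layerConst_nonneg T hθ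
  -- For `d = 0` the choice `δ = d` is not positive, so `δ` tends to `0` instead.
  rcases hd0.eq_or_lt with rfl | hd
  · rw [mul_zero]
    refine le_of_forall_pos_le_add fun ε hε => ?_
    have h := key (ε / (layerConst T θ + 1)) (by positivity)
    refine h.trans ?_
    have : layerConst T θ * (ε / (layerConst T θ + 1)) ≤ ε := by
      rw [mul_div_assoc', div_le_iff₀ (by positivity)]
      nlinarith
    simpa using this
  · refine (key d hd).trans ?_
    have h1 : d ^ 4 / d ^ 2 ≤ d := by
      rw [div_le_iff₀ (by positivity)]
      nlinarith [pow_pos hd 3]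
    calc layerConst T θ * (d + M * (d ^ 4 / d ^ 2)) ≤ layerConst T θ * (d + M * d) := by gcongr
      _ = layerConst T θ * (1 + M) * d := by ring

lemma sum_snnGaussian_real_spikesDiffer_zero_le (β θ : ℝ) (n : ℕ) (T : ℕ)
    (x y : ℕ → Fin (N 0) → ℝ) :
    ∑ j, (snnGaussian N n).real (spikesDiffer β θ N T x y 0 j) ≤
      ∑ t ∈ Finset.Icc 1 T, (hammingDist (x t) (y t) : ℝ) := by
  have hham (t : ℕ) : (hammingDist (x t) (y t) : ℝ) = ∑ j, if x t j ≠ y t j then 1 else 0 := by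
    rw [hammingDist, Finset.sum_boole]
  simp only [hham]
  rw [Finset.sum_comm]
  refine Finset.sum_le_sum fun j _ => ?_
  by_cases h : ∃ t ∈ Finset.Icc 1 T, x t j ≠ y t j
  · obtain ⟨t, ht, hne⟩ := h
    refine measureReal_le_one.trans ?_
    have := Finset.single_le_sum (f := fun t => if x t j ≠ y t j then (1 : ℝ) else 0)
      (fun t _ => by split_ifs <;> simp) ht
    simpa only [if_pos hne] using this
  · have hempty : spikesDiffer β θ N T x y 0 j = ∅ :=
      Set.eq_empty_of_forall_notMem fun W hW => h hW
    rw [hempty, measureReal_empty]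
    exact Finset.sum_nonneg fun t _ => by split_ifs <;> simp

/-- The induction runs on sums over a layer, since the input coordinates are deterministic: each
flips with probability `0` or `1`, and only their average is small. -/
lemma sum_snnGaussian_real_spikesDiffer_le {n : ℕ} (hn : 0 < n) {T : ℕ} {θ ν : ℝ} (hθ : 0 < θ)
    (hN : ∀ l : Fin L, N l.castSucc = n) (hN0 : N 0 = n)
    {x y : ℕ → Fin (N 0) → ℝ} (hx : ∀ t ∈ Finset.Icc 1 T, ∀ j, |x t j| ≤ 1)
    (hy : ∀ t ∈ Finset.Icc 1 T, ∀ j, |y t j| ≤ 1) (hν0 : 0 ≤ ν) (hν1 : ν ≤ 1)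
    (hxy : ∀ t ∈ Finset.Icc 1 T, (hammingDist (x t) (y t) : ℝ) ≤ ν * n) (l : Fin (L + 1)) :
    ∑ j, (snnGaussian N n).real (spikesDiffer 1 θ N T x y l j) ≤
      N l * (flipConst T θ l * ν ^ ((1 : ℝ) / 4 ^ (l : ℕ))) := by
  induction l using Fin.induction with
  | zero =>
    refine (sum_snnGaussian_real_spikesDiffer_zero_le 1 θ n T x y).trans
      ((Finset.sum_le_sum hxy).trans (le_of_eq ?_))
    rw [hN0]
    simp only [Finset.sum_const, Nat.card_Icc, Nat.add_sub_cancel, nsmul_eq_mul, Fin.val_zero,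
      flipConst, pow_zero, div_one, Real.rpow_one]
    ring
  | succ l ih =>
    rw [congrArg (Nat.cast (R := ℝ)) (hN l), Fin.val_castSucc] at ih
    set d : ℝ := ν ^ ((1 : ℝ) / 4 ^ ((l : ℕ) + 1)) with hd
    have hd4 : d ^ 4 = ν ^ ((1 : ℝ) / 4 ^ (l : ℕ)) := by
      rw [hd, ← Real.rpow_natCast, ← Real.rpow_mul hν0]
      congr 1
      rw [pow_succ]
      push_cast
      field_simp
    rw [← hd4] at ih
    refine (Finset.sum_le_card_nsmul _ _ _ fun i _ =>
      snnGaussian_real_spikesDiffer_succ_le hn hθ hx hy l (flipConst_nonneg T hθ l)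
        (Real.rpow_nonneg hν0 _) (Real.rpow_le_one hν0 hν1 (by positivity)) ih i).trans
      (le_of_eq ?_)
    simp only [Finset.card_univ, Fintype.card_fin, nsmul_eq_mul, Fin.val_succ, flipConst]

/-- If no output neuron flips, the spike counts coincide, and `sel` sees nothing else; so ties do
not matter. -/
lemma snnClassifier_ne_subset (β θ : ℝ) (T : ℕ)
    (sel : (Fin (N (Fin.last L)) → ℝ) → Fin (N (Fin.last L))) (x y : ℕ → Fin (N 0) → ℝ) :
    {W | snnClassifier β θ N T sel x W ≠ snnClassifier β θ N T sel y W} ⊆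
      ⋃ i, spikesDiffer β θ N T x y (Fin.last L) i := by
  intro W hW
  by_contra hc
  simp only [Set.mem_iUnion, spikesDiffer, Set.mem_ofPred_eq, not_exists, not_and, not_not] at hc
  refine hW ?_
  unfold snnClassifier
  congr 1
  ext i
  exact Finset.sum_congr rfl fun t ht => hc i t ht

end Propagation

/-! ### Absorbing the constants and conclusion -/

lemma eventually_mul_div_sqrt_rpow_le_one (M K : ℝ) {e : ℝ} (he : 0 < e) :
    ∀ᶠ n : ℕ in Filter.atTop, M * (K / √(n : ℝ)) ^ e ≤ 1 := by
  have h1 : Filter.Tendsto (fun n : ℕ => K / √(n : ℝ)) Filter.atTop (nhds 0) :=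
    (Real.tendsto_sqrt_atTop.comp tendsto_natCast_atTop_atTop).const_div_atTop K
  have h2 := (h1.rpow_const (Or.inr he.le)).const_mul M
  rw [Real.zero_rpow he.ne', mul_zero] at h2
  exact h2.eventually (eventually_le_nhds one_pos)

theorem theorem2 :
    ∃ C c : ℝ, 0 < C ∧ 0 < c ∧
      ∀ (L T : ℕ) (θ K : ℝ), 1 ≤ L → 1 ≤ T → 0 < θ →
        ∃ n₀ : ℕ, ∀ n : ℕ, n₀ ≤ n →
          ∀ N : Fin (L + 1) → ℕ, (∀ l : Fin L, N l.castSucc = n) →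
          ∀ sel : (Fin (N (Fin.last L)) → ℝ) → Fin (N (Fin.last L)), IsArgmax sel →
          ∀ (x y : ℕ → Fin (N 0) → ℝ) (ν : ℕ → ℝ) (νmax : ℝ),
            (∀ t ∈ Set.Icc 1 T, ∀ i, x t i = -1 ∨ x t i = 1) →
            (∀ t ∈ Set.Icc 1 T, ∀ i, y t i = -1 ∨ y t i = 1) →
            (∀ t ∈ Set.Icc 1 T, 0 ≤ ν t ∧ ν t ≤ 1) →
            (∀ t ∈ Set.Icc 1 T, hammingDist (x t) (y t) = ⌊ν t * (n : ℝ)⌋₊) →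
            IsGreatest (ν '' Set.Icc 1 T) νmax →
            νmax ≤ K / √(n : ℝ) →
            (snnGaussian N n).real
                {W | snnClassifier 1 θ N T sel x W ≠ snnClassifier 1 θ N T sel y W} ≤
              (N (Fin.last L) : ℝ) * (T : ℝ) ^ 4 * C * (1 + θ) *
                  νmax ^ ((1 : ℝ) / 2 ^ (2 * L + 1)) * Real.log (n : ℝ) ^ ((3 : ℝ) / 2) +
                ((L : ℝ) - 1) * Real.exp (-c * νmax ^ ((1 : ℝ) / 2 ^ (2 * L - 1)) * (n : ℝ)) := by
  refine ⟨1, 1, one_pos, one_pos, fun L T θ K hL hT hθ => ?_⟩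
  set e : ℝ := (1 : ℝ) / 2 ^ (2 * L + 1) with he
  have he0 : 0 < e := by positivity
  have hM := flipConst_nonneg T hθ L
  obtain ⟨n₁, hn₁⟩ := Filter.eventually_atTop.1
    (eventually_mul_div_sqrt_rpow_le_one (flipConst T θ L) K he0)
  -- `3 > exp 1` makes the logarithmic factor at least `1`.
  refine ⟨max n₁ 3, fun n hn N hN sel _ x y ν νmax hx hy hν hxy hmax hνK => ?_⟩
  have hn3 : 3 ≤ n := (le_max_right _ _).trans hn
  have hN0 : N 0 = n := hN ⟨0, hL⟩
  obtain ⟨⟨t₀, ht₀, rfl⟩, hub⟩ := hmax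
  obtain ⟨hν0, hν1⟩ := hν t₀ ht₀
  have habs {z : ℕ → Fin (N 0) → ℝ} (hz : ∀ t ∈ Set.Icc 1 T, ∀ i, z t i = -1 ∨ z t i = 1) :
      ∀ t ∈ Finset.Icc 1 T, ∀ i, |z t i| ≤ 1 := fun t ht i => by
    rcases hz t (by simpa using ht) i with h | h <;> simp [h]
  have hham : ∀ t ∈ Finset.Icc 1 T, (hammingDist (x t) (y t) : ℝ) ≤ ν t₀ * n := fun t ht => by
    have ht' : t ∈ Set.Icc 1 T := by simpa using ht
    rw [hxy t ht']
    refine (Nat.floor_le (mul_nonneg (hν t ht').1 n.cast_nonneg)).trans ?_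
    gcongr
    exact hub ⟨t, ht', rfl⟩
  have hflip := sum_snnGaussian_real_spikesDiffer_le (by lia) hθ hN hN0 (habs hx) (habs hy)
    hν0 hν1 hham (Fin.last L)
  -- `1 / 4 ^ L = 2 * e`: one factor `ν ^ e` is spare to beat `flipConst T θ L`.
  have hsq : ν t₀ ^ ((1 : ℝ) / 4 ^ L) = ν t₀ ^ e * ν t₀ ^ e := by
    rw [← Real.rpow_add_of_nonneg hν0 he0.le he0.le]
    congr 1
    rw [he, pow_succ, pow_mul]
    norm_num
    ring
  have hsmall : flipConst T θ L * ν t₀ ^ e ≤ 1 :=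
    (mul_le_mul_of_nonneg_left (Real.rpow_le_rpow hν0 hνK he0.le) hM).trans
      (hn₁ n ((le_max_left _ _).trans hn))
  have hlog : 1 ≤ Real.log (n : ℝ) ^ ((3 : ℝ) / 2) := by
    refine Real.one_le_rpow ?_ (by norm_num)
    have h3 : (3 : ℝ) ≤ n := by exact_mod_cast hn3
    rw [Real.le_log_iff_exp_le (by linarith)]
    linarith [Real.exp_one_lt_d9]
  have hT4 : (1 : ℝ) ≤ (T : ℝ) ^ 4 := one_le_pow₀ (by exact_mod_cast hT)
  have hL1 : (0 : ℝ) ≤ (L : ℝ) - 1 := by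
    have : (1 : ℝ) ≤ L := by exact_mod_cast hL
    linarith
  have hpow : 0 ≤ ν t₀ ^ e := Real.rpow_nonneg hν0 e
  calc (snnGaussian N n).real
        {W | snnClassifier 1 θ N T sel x W ≠ snnClassifier 1 θ N T sel y W}
      ≤ (snnGaussian N n).real (⋃ i, spikesDiffer 1 θ N T x y (Fin.last L) i) :=
        measureReal_mono (snnClassifier_ne_subset 1 θ T sel x y)
    _ ≤ ∑ i, (snnGaussian N n).real (spikesDiffer 1 θ N T x y (Fin.last L) i) :=
        measureReal_iUnion_fintype_le _
    _ ≤ N (Fin.last L) * (flipConst T θ L * (ν t₀ ^ e * ν t₀ ^ e)) := by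
        rwa [Fin.val_last, hsq] at hflip
    _ = N (Fin.last L) * ((flipConst T θ L * ν t₀ ^ e) * ν t₀ ^ e) := by ring
    _ ≤ N (Fin.last L) * (1 * ν t₀ ^ e) := by gcongr
    _ = N (Fin.last L) * 1 * 1 * 1 * ν t₀ ^ e * 1 := by ring
    _ ≤ (N (Fin.last L) : ℝ) * (T : ℝ) ^ 4 * 1 * (1 + θ) * ν t₀ ^ e *
          Real.log (n : ℝ) ^ ((3 : ℝ) / 2) := by
        gcongr
        linarith
    -- The exponential term is nonnegative because `1 ≤ L`; nothing more about it is needed.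
    _ ≤ _ := le_add_of_nonneg_right (mul_nonneg hL1 (Real.exp_pos _).le)
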